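/- For integers $m,n\ge 0$ let $$\mathbb{P}_{m,n}=\{(p,q)\in\mathbb{C}[x]^2 : \deg p\le m,\ \deg q\le n\},$$ a complex vector space of dimension $m+n+2$, equipped with the norm $\|(p,q)\|=\sqrt{\|p\|^2+\|q\|^2}$, where the norm of a polynomial is the Euclidean norm of its vector of coefficients. A greatest common divisor of $(p,q)$ is any common divisor of $p$ and $q$ of the highest degree. For $k\ge 0$ let $$\mathscr{P}^k_{m,n}=\{(p,q)\in\mathbb{P}_{m,n} : \deg p=m,\ \deg q=n,\ \deg(\gcd(p,q))=k\}.$$ A subset $\Pi\subset\mathbb{P}_{m,n}$ is called a (complex) differentiable manifold of dimension $d$ if every point of $\Pi$ has an open neighborhood $\Delta$ in $\mathbb{P}_{m,n}$ for which there is a continuously (complex) differentiable bijection $\mathbf{g}$ from $\Delta\cap\Pi$ onto an open subset $\Lambda$ of $\mathbb{C}^d$ with a continuously differentiable inverse $\mathbf{g}^{-1}:\Lambda\to\Delta\cap\Pi$ (a map on $\Delta\cap\Pi$ is continuously differentiable if it is locally the restriction of a continuously differentiable map on an open subset of $\mathbb{P}_{m,n}$); its codimension is then $\dim\mathbb{P}_{m,n}-d=m+n+2-d$.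 **Theorem 4.1 (GCD Manifold Theorem).** With respect to the topology of $\mathbb{P}_{m,n}$ induced by the norm $\|\cdot\|$: 1. for every $0\le k\le\min\{m,n\}$, the set $\mathscr{P}^k_{m,n}$ is a differentiable manifold of codimension $k$ in $\mathbb{P}_{m,n}$; 2. for all $0\le j\le\min\{m,n\}$ and $k\ge 0$, one has $\mathscr{P}^j_{m,n}\subset\overline{\mathscr{P}^k_{m,n}}$ if and only if $j\ge k$; 3. $\mathscr{P}^0_{m,n}$ is open and dense in $\mathbb{P}_{m,n}$. -/

import Mathlib

open Polynomial

noncomputable section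

namespace GCDManifold

/-- The vector space of complex polynomials of degree at most `n`. -/
abbrev PolySpace (n : ℕ) : Type := Polynomial.degreeLE ℂ (n : WithBot ℕ)

/-- The coefficient vector `[ρ₀; …; ρₙ]` of a polynomial `ρ₀ + ρ₁ x + ⋯ + ρₙ xⁿ`. -/
def coeffVec (n : ℕ) : PolySpace n →ₗ[ℂ] EuclideanSpace ℂ (Fin (n + 1)) where
  toFun p := WithLp.toLp 2 fun i => (p : ℂ[X]).coeff i
  map_add' p q := by ext i; simp
  map_smul' c p := by ext i; simp

theorem coeffVec_injective (n : ℕ) : Function.Injective (coeffVec n) := by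
  intro p q h
  apply Subtype.ext
  ext i
  by_cases hi : i < n + 1
  · have h2 : coeffVec n p ⟨i, hi⟩ = coeffVec n q ⟨i, hi⟩ := by rw [h]
    exact h2
  · have hlt : (n : WithBot ℕ) < (i : WithBot ℕ) := by
      exact_mod_cast (show n < i by omega)
    have hp := Polynomial.mem_degreeLE.1 p.2
    have hq := Polynomial.mem_degreeLE.1 q.2
    rw [Polynomial.coeff_eq_zero_of_degree_lt (lt_of_le_of_lt hp hlt),
      Polynomial.coeff_eq_zero_of_degree_lt (lt_of_le_of_lt hq hlt)]

/-- The norm of a polynomial is the Euclidean norm of its coefficient vector. -/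
instance instNormedAddCommGroupPolySpace (n : ℕ) : NormedAddCommGroup (PolySpace n) :=
  NormedAddCommGroup.induced (PolySpace n) (EuclideanSpace ℂ (Fin (n + 1)))
    (coeffVec n) (coeffVec_injective n)

instance instNormedSpacePolySpace (n : ℕ) : NormedSpace ℂ (PolySpace n) :=
  NormedSpace.induced ℂ (PolySpace n) (EuclideanSpace ℂ (Fin (n + 1))) (coeffVec n)

/-- The space of pairs `(p, q)` with `deg p ≤ m` and `deg q ≤ n`, with the norm
`‖(p, q)‖ = √(‖p‖² + ‖q‖²)`. -/
abbrev PolyPair (m n : ℕ) : Type := WithLp 2 (PolySpace m × PolySpace n)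

/-- The set of all greatest common divisors of `p` and `q`: the common divisors of the highest
degree. -/
def gcdSet (p q : ℂ[X]) : Set ℂ[X] :=
  {u | u ∣ p ∧ u ∣ q ∧ ∀ d : ℂ[X], d ∣ p → d ∣ q → d.degree ≤ u.degree}

/-- The pairs `(p, q)` of degrees exactly `m` and `n`. -/
def exactPairs (m n : ℕ) : Set (PolyPair m n) :=
  {z | (z.fst : ℂ[X]).degree = (m : WithBot ℕ) ∧ (z.snd : ℂ[X]).degree = (n : WithBot ℕ)}

/-- The pairs of degrees exactly `m` and `n` whose greatest common divisors have degree `k`. -/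
def gcdPairs (m n k : ℕ) : Set (PolyPair m n) :=
  {z | z ∈ exactPairs m n ∧
    ∃ u ∈ gcdSet (z.fst : ℂ[X]) (z.snd : ℂ[X]), u.degree = (k : WithBot ℕ)}

/-- A subset `S` of a complex normed space is a (complex) differentiable manifold of dimension `d`:
every point of `S` has an open neighbourhood `U` such that some continuously (complex)
differentiable map `g` sends `U ∩ S` bijectively onto an open subset `V` of `ℂ ^ d`, with a
continuously differentiable inverse `h : V → U ∩ S`. As usual, a map on the subset `U ∩ S` is
continuously differentiable when it is, locally, the restriction of a continuously differentiable
map on an open set of the ambient space (after shrinking `U`, on all of `U`). -/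
def IsDifferentiableManifold {E : Type*} [NormedAddCommGroup E] [NormedSpace ℂ E]
    (d : ℕ) (S : Set E) : Prop :=
  ∀ x ∈ S, ∃ (U : Set E) (V : Set (EuclideanSpace ℂ (Fin d)))
    (g : E → EuclideanSpace ℂ (Fin d)) (h : EuclideanSpace ℂ (Fin d) → E),
    IsOpen U ∧ x ∈ U ∧ IsOpen V ∧
    ContDiffOn ℂ 1 g U ∧ ContDiffOn ℂ 1 h V ∧
    Set.MapsTo g (U ∩ S) V ∧ Set.MapsTo h V (U ∩ S) ∧
    Set.InvOn h g (U ∩ S) V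

/-- `S` is a differentiable manifold of some dimension `d`, and `dim E - d = c`. -/
def IsManifoldOfCodim {E : Type*} [NormedAddCommGroup E] [NormedSpace ℂ E]
    (c : ℕ) (S : Set E) : Prop :=
  ∃ d : ℕ, IsDifferentiableManifold d S ∧ d + c = Module.finrank ℂ E

end GCDManifold

end

/-!
The set of pairs of exact degrees `m` and `n` with gcd of degree `k` is parametrized by
`(u, v, w) ↦ (u v, u w)`, where `u` is monic of degree `k` and `deg v ≤ m - k`, `deg w ≤ n - k`.
There are `k + (m - k + 1) + (n - k + 1) = m + n + 2 - k` coordinates, which gives the codimension.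

A differentiable inverse is written down explicitly, without the inverse function theorem. The map
sending `(a, b)`, with `deg a ≤ n - k` and `deg b < m - k`, to the coefficients of `a p + b q` of
index at least `k` is a square linear map. It is bijective when `gcd (p, q)` has degree `k`
(`det_subresultantMatrix_ne_zero`), hence on an open set of pairs, the `regularPairs`. There the
system can be solved for a combination `a p + b q` that is monic of degree `k`
(`degree_subresultantPoly_sub_lt`), and by Cramer's rule this `gcdCandidate` depends differentiably
on `(p, q)`. Every common divisor divides it. So common divisors of a regular pair have degree at
most `k`, and if there is one of degree `k`, it is the candidate, up to a constant factor. The chart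
is `(p, q) ↦ (u, p / u, q / u)` with `u` the candidate; division by a monic polynomial is
differentiable in the coefficients (`CoeffContDiffOn.divByMonic`).

The bound on degrees over `regularPairs` shows that the gcd degree does not increase under small
perturbations (`le_of_mem_closure_gcdPairs`). Conversely, the gcd degree can be lowered to any
smaller value: if `p = d f` and `q = d g`, then `f` and `g + ε` are coprime for all but finitely
many `ε`, so that `(p, q + ε d)` has gcd `d` (`gcdPairs_subset_closure`). For `k = 0` the regular
pairs are exactly the coprime ones of full degree, which form an open set. It is dense because the
pairs of full degree are dense and the gcd degree can be lowered to `0`.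
-/

noncomputable section

namespace GCDManifold

/-! ### Coefficientwise differentiability -/

section Smooth

variable {E : Type*} [NormedAddCommGroup E] [NormedSpace ℂ E] {s : Set E}

/-- A polynomial-valued map is continuously differentiable when all its coefficients are. -/
def CoeffContDiffOn (f : E → ℂ[X]) (s : Set E) : Prop :=
  ∀ i, ContDiffOn ℂ 1 (fun x => (f x).coeff i) s

theorem CoeffContDiffOn.add {f g : E → ℂ[X]} (hf : CoeffContDiffOn f s)
    (hg : CoeffContDiffOn g s) : CoeffContDiffOn (fun x => f x + g x) s := fun i => by
  simpa only [coeff_add] using (hf i).add (hg i)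

theorem CoeffContDiffOn.mul {f g : E → ℂ[X]} (hf : CoeffContDiffOn f s)
    (hg : CoeffContDiffOn g s) : CoeffContDiffOn (fun x => f x * g x) s := fun i => by
  simp only [coeff_mul]
  exact ContDiffOn.sum fun a _ => (hf a.1).mul (hg a.2)

theorem coeffContDiffOn_const (p : ℂ[X]) : CoeffContDiffOn (fun _ : E => p) s :=
  fun _ => contDiffOn_const

theorem CoeffContDiffOn.toFn {f : E → ℂ[X]} (hf : CoeffContDiffOn f s) (N : ℕ) :
    ContDiffOn ℂ 1 (fun x => Polynomial.toFn N (f x)) s :=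
  contDiffOn_pi' fun i => hf i

theorem coeffContDiffOn_ofFn {N : ℕ} {f : E → Fin N → ℂ} (hf : ContDiffOn ℂ 1 f s) :
    CoeffContDiffOn (fun x => ofFn N (f x)) s := fun i => by
  by_cases hi : i < N
  · simpa only [ofFn_coeff_eq_val_of_lt _ hi] using contDiffOn_pi.1 hf ⟨i, hi⟩
  · simpa only [ofFn_coeff_eq_zero_of_ge _ (not_lt.1 hi)] using contDiffOn_const

/-- The coefficients of the quotient by a monic polynomial are obtained from the top one downwards
by polynomial formulas in the coefficients of the dividend and the divisor. -/
theorem CoeffContDiffOn.divByMonic {f u : E → ℂ[X]} {k N : ℕ} (hf : CoeffContDiffOn f s)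
    (hu : CoeffContDiffOn u s) (hmonic : ∀ x ∈ s, (u x).Monic)
    (hdeg : ∀ x ∈ s, (u x).natDegree = k) (hN : ∀ x ∈ s, (f x).natDegree ≤ N) :
    CoeffContDiffOn (fun x => f x /ₘ u x) s := by
  suffices H : ∀ l i, N < i + l → ContDiffOn ℂ 1 (fun x => (f x /ₘ u x).coeff i) s from
    fun i => H (N + 1) i (by omega)
  intro l
  induction l with
  | zero =>
    intro i hi
    refine (contDiffOn_const (c := (0 : ℂ))).congr fun x hx => ?_
    refine coeff_eq_zero_of_natDegree_lt ?_
    rw [natDegree_divByMonic _ (hmonic x hx)]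
    have := hN x hx
    omega
  | succ l ih =>
    intro i hi
    have hsum : ContDiffOn ℂ 1 (fun x => (f x).coeff (k + i) -
        ∑ a ∈ (Finset.HasAntidiagonal.antidiagonal (k + i)).erase (k, i),
          (u x).coeff a.1 * (f x /ₘ u x).coeff a.2) s := by
      refine (hf _).sub (ContDiffOn.sum fun a ha => ?_)
      obtain ⟨hne, hmem⟩ := Finset.mem_erase.1 ha
      have hadd := Finset.HasAntidiagonal.mem_antidiagonal.1 hmem
      rcases lt_trichotomy a.1 k with hlt | heq | hgt
      · exact (hu _).mul (ih _ (by omega))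
      · exact absurd (Prod.ext heq (by simp only; omega)) hne
      · refine (contDiffOn_const (c := (0 : ℂ))).congr fun x hx => ?_
        rw [coeff_eq_zero_of_natDegree_lt (by rw [hdeg x hx]; exact hgt), zero_mul]
    refine hsum.congr fun x hx => ?_
    have hr : (f x %ₘ u x).coeff (k + i) = 0 := by
      refine coeff_eq_zero_of_degree_lt ((degree_modByMonic_lt _ (hmonic x hx)).trans_le ?_)
      refine degree_le_natDegree.trans ?_
      rw [hdeg x hx]
      exact_mod_cast Nat.le_add_right k i
    have hlead : (u x).coeff k = 1 := by
      have := (hmonic x hx).coeff_natDegree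
      rwa [hdeg x hx] at this
    have hkey : (f x).coeff (k + i) = (u x * (f x /ₘ u x)).coeff (k + i) := by
      conv_lhs => rw [← modByMonic_add_div (f x) (u x)]
      rw [coeff_add, hr, zero_add]
    rw [coeff_mul, ← Finset.add_sum_erase _ _ (Finset.HasAntidiagonal.mem_antidiagonal.2 rfl :
      (k, i) ∈ Finset.HasAntidiagonal.antidiagonal (k + i)), hlead, one_mul] at hkey
    rw [hkey, add_sub_cancel_right]

variable {ι : Type*} [Fintype ι] [DecidableEq ι]

theorem contDiffOn_det {M : E → Matrix ι ι ℂ}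
    (hM : ∀ i j, ContDiffOn ℂ 1 (fun x => M x i j) s) :
    ContDiffOn ℂ 1 (fun x => (M x).det) s := by
  simp only [Matrix.det_apply]
  exact ContDiffOn.sum fun σ _ => (contDiffOn_prod fun i _ => hM _ _).const_smul _

/-- By Cramer's rule, the solution of a nonsingular linear system is continuously differentiable
when the coefficients of the system are. -/
theorem contDiffOn_inv_mulVec {M : E → Matrix ι ι ℂ} (y : ι → ℂ)
    (hM : ∀ i j, ContDiffOn ℂ 1 (fun x => M x i j) s) (hdet : ∀ x ∈ s, (M x).det ≠ 0) :
    ContDiffOn ℂ 1 (fun x => Matrix.mulVec (M x)⁻¹ y) s := by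
  refine contDiffOn_pi' fun i => ?_
  have h : ∀ x, Matrix.mulVec (M x)⁻¹ y i = (M x).det⁻¹ * ((M x).updateCol i y).det := by
    intro x
    rw [Matrix.inv_def, Matrix.smul_mulVec, Ring.inverse_eq_inv',
      ← Matrix.cramer_eq_adjugate_mulVec, Pi.smul_apply, Matrix.cramer_apply, smul_eq_mul]
  simp only [h]
  refine ((contDiffOn_det hM).inv hdet).mul (contDiffOn_det fun a b => ?_)
  by_cases hb : b = i
  · simpa [hb, Matrix.updateCol_apply] using contDiffOn_const
  · simpa [hb, Matrix.updateCol_apply] using hM a b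

end Smooth

/-! ### The space of pairs -/

/-- The identification of polynomials of degree at most `n` with their coefficient vectors. -/
def coeffEquiv (n : ℕ) : PolySpace n ≃ₗ[ℂ] EuclideanSpace ℂ (Fin (n + 1)) :=
  LinearEquiv.ofBijective (coeffVec n) ⟨coeffVec_injective n, fun v => by
    refine ⟨⟨ofFn (n + 1) v, ?_⟩, ?_⟩
    · refine mem_degreeLE.2 ?_
      rw [degree_le_iff_coeff_zero]
      intro i hi
      exact ofFn_coeff_eq_zero_of_ge _ (by exact_mod_cast hi)
    · ext i
      exact ofFn_coeff_eq_val_of_lt _ i.isLt⟩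

instance (n : ℕ) : FiniteDimensional ℂ (PolySpace n) :=
  (coeffEquiv n).symm.finiteDimensional

instance (m n : ℕ) : FiniteDimensional ℂ (PolyPair m n) :=
  (WithLp.linearEquiv 2 ℂ (PolySpace m × PolySpace n)).symm.finiteDimensional

theorem finrank_polyPair (m n : ℕ) : Module.finrank ℂ (PolyPair m n) = m + n + 2 := by
  rw [(WithLp.linearEquiv 2 ℂ (PolySpace m × PolySpace n)).finrank_eq, Module.finrank_prod,
    (coeffEquiv m).finrank_eq, (coeffEquiv n).finrank_eq]
  simp
  omega

theorem degree_fst_le {m n : ℕ} (z : PolyPair m n) : (z.fst : ℂ[X]).degree ≤ m :=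
  mem_degreeLE.1 z.fst.2

theorem degree_snd_le {m n : ℕ} (z : PolyPair m n) : (z.snd : ℂ[X]).degree ≤ n :=
  mem_degreeLE.1 z.snd.2

theorem coeffContDiffOn_fst {m n : ℕ} (s : Set (PolyPair m n)) :
    CoeffContDiffOn (fun z : PolyPair m n => (z.fst : ℂ[X])) s := fun i =>
  (LinearMap.toContinuousLinearMap (lcoeff ℂ i ∘ₗ (degreeLE ℂ m).subtype ∘ₗ
    LinearMap.fst ℂ _ _ ∘ₗ
      (WithLp.linearEquiv 2 ℂ (PolySpace m × PolySpace n)).toLinearMap)).contDiff.contDiffOn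

theorem coeffContDiffOn_snd {m n : ℕ} (s : Set (PolyPair m n)) :
    CoeffContDiffOn (fun z : PolyPair m n => (z.snd : ℂ[X])) s := fun i =>
  (LinearMap.toContinuousLinearMap (lcoeff ℂ i ∘ₗ (degreeLE ℂ n).subtype ∘ₗ
    LinearMap.snd ℂ _ _ ∘ₗ
      (WithLp.linearEquiv 2 ℂ (PolySpace m × PolySpace n)).toLinearMap)).contDiff.contDiffOn

/-- The pair of polynomials with given coefficient vectors. -/
def pairOfCoeffs (m n : ℕ) : (Fin (m + 1) → ℂ) × (Fin (n + 1) → ℂ) →L[ℂ] PolyPair m n :=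
  LinearMap.toContinuousLinearMap ((WithLp.linearEquiv 2 ℂ (PolySpace m × PolySpace n)).symm ∘ₗ
    LinearMap.prodMap
      ((coeffEquiv m).symm.toLinearMap ∘ₗ (WithLp.linearEquiv 2 ℂ (Fin (m + 1) → ℂ)).symm)
      ((coeffEquiv n).symm.toLinearMap ∘ₗ (WithLp.linearEquiv 2 ℂ (Fin (n + 1) → ℂ)).symm))

theorem coeffEquiv_symm_toFn {n : ℕ} {p : ℂ[X]} (hp : p.degree ≤ n) :
    (((coeffEquiv n).symm (WithLp.toLp 2 (toFn (n + 1) p)) : PolySpace n) : ℂ[X]) = p := by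
  have h : (coeffEquiv n).symm (WithLp.toLp 2 (toFn (n + 1) p)) = ⟨p, mem_degreeLE.2 hp⟩ := by
    rw [LinearEquiv.symm_apply_eq]
    rfl
  rw [h]

theorem pairOfCoeffs_fst {m n : ℕ} {p : ℂ[X]} (hp : p.degree ≤ m) (v : Fin (n + 1) → ℂ) :
    ((pairOfCoeffs m n (toFn (m + 1) p, v)).fst : ℂ[X]) = p :=
  coeffEquiv_symm_toFn hp

theorem pairOfCoeffs_snd {m n : ℕ} {q : ℂ[X]} (hq : q.degree ≤ n) (v : Fin (m + 1) → ℂ) :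
    ((pairOfCoeffs m n (v, toFn (n + 1) q)).snd : ℂ[X]) = q :=
  coeffEquiv_symm_toFn hq

/-! ### Pairs with a prescribed gcd degree -/

theorem mem_gcdPairs_iff {m n k : ℕ} {z : PolyPair m n} :
    z ∈ gcdPairs m n k ↔ z ∈ exactPairs m n ∧ ∃ u v w : ℂ[X], u.degree = k ∧
      (z.fst : ℂ[X]) = u * v ∧ (z.snd : ℂ[X]) = u * w ∧ IsCoprime v w := by
  refine and_congr_right fun _ => ⟨?_, ?_⟩
  · rintro ⟨u, ⟨⟨v, hv⟩, ⟨w, hw⟩, hmax⟩, hu⟩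
    refine ⟨u, v, w, hu, hv, hw, ?_⟩
    rw [isCoprime_iff_aeval_ne_zero_of_isAlgClosed ℂ ℂ]
    intro a
    by_contra! h
    simp only [coe_aeval_eq_eval] at h
    have hva : X - C a ∣ v := dvd_iff_isRoot.2 h.1
    have hwa : X - C a ∣ w := dvd_iff_isRoot.2 h.2
    have h1 := hmax (u * (X - C a)) (hv ▸ mul_dvd_mul_left u hva) (hw ▸ mul_dvd_mul_left u hwa)
    rw [degree_mul, degree_X_sub_C, hu] at h1
    have h2 : k + 1 ≤ k := by exact_mod_cast h1
    omega
  · rintro ⟨u, v, w, hu, hv, hw, ⟨a, b, hab⟩⟩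
    refine ⟨u, ⟨⟨v, hv⟩, ⟨w, hw⟩, fun d hdp hdq => ?_⟩, hu⟩
    have hu0 : u ≠ 0 := by
      rintro rfl
      simp at hu
    refine degree_le_of_dvd ?_ hu0
    have : u = a * (u * v) + b * (u * w) := by linear_combination -u * hab
    rw [this, ← hv, ← hw]
    exact dvd_add (hdp.mul_left a) (hdq.mul_left b)

theorem exists_mem_gcdPairs {m n : ℕ} {z : PolyPair m n} (hz : z ∈ exactPairs m n) :
    ∃ k, z ∈ gcdPairs m n k := by
  classical
  have hp : (z.fst : ℂ[X]) ≠ 0 := by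
    intro h
    simpa [h] using hz.1
  refine ⟨(EuclideanDomain.gcd (z.fst : ℂ[X]) (z.snd : ℂ[X])).natDegree, hz, _,
    ⟨EuclideanDomain.gcd_dvd_left _ _, EuclideanDomain.gcd_dvd_right _ _, fun d h1 h2 => ?_⟩,
    degree_eq_natDegree ?_⟩
  · exact degree_le_of_dvd (EuclideanDomain.dvd_gcd h1 h2)
      fun h => hp (EuclideanDomain.gcd_eq_zero_iff.1 h).1
  · exact fun h => hp (EuclideanDomain.gcd_eq_zero_iff.1 h).1

theorem degree_eq_iff_coeff_ne_zero {p : ℂ[X]} {m : ℕ} (hp : p.degree ≤ m) :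
    p.degree = m ↔ p.coeff m ≠ 0 :=
  ⟨fun h => coeff_ne_zero_of_eq_degree h, fun h => le_antisymm hp (le_degree_of_ne_zero h)⟩

theorem isOpen_exactPairs (m n : ℕ) : IsOpen (exactPairs m n) := by
  have h : exactPairs m n = {z : PolyPair m n | (z.fst : ℂ[X]).coeff m ≠ 0} ∩
      {z : PolyPair m n | (z.snd : ℂ[X]).coeff n ≠ 0} := by
    ext z
    exact and_congr (degree_eq_iff_coeff_ne_zero (degree_fst_le z))
      (degree_eq_iff_coeff_ne_zero (degree_snd_le z))
  rw [h]
  refine IsOpen.inter ?_ ?_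
  · exact isOpen_ne_fun
      (continuousOn_univ.1 (coeffContDiffOn_fst Set.univ m).continuousOn) continuous_const
  · exact isOpen_ne_fun
      (continuousOn_univ.1 (coeffContDiffOn_snd Set.univ n).continuousOn) continuous_const

/-! ### Subresultants -/

/-- The combination `a p + b q`, where `a` and `b` have the coefficient vectors `c ∘ Sum.inl` and
`c ∘ Sum.inr`. -/
def bezoutCombination (r s : ℕ) (p q : ℂ[X]) : (Fin r ⊕ Fin s → ℂ) →ₗ[ℂ] ℂ[X] :=
  LinearMap.mulRight ℂ p ∘ₗ ofFn r ∘ₗ LinearMap.funLeft ℂ ℂ Sum.inl +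
    LinearMap.mulRight ℂ q ∘ₗ ofFn s ∘ₗ LinearMap.funLeft ℂ ℂ Sum.inr

/-- The matrix of the map sending `(a, b)`, with `deg a < r` and `deg b < s`, to the coefficients
of `a p + b q` of index `k, …, k + r + s - 1`. For suitable `r` and `s` its determinant is a
subresultant of `p` and `q`. -/
def subresultantMatrix (r s k : ℕ) (p q : ℂ[X]) :
    Matrix (Fin r ⊕ Fin s) (Fin r ⊕ Fin s) ℂ :=
  LinearMap.toMatrix' (LinearMap.pi fun i => lcoeff ℂ (k + finSumFinEquiv i) ∘ₗ
    bezoutCombination r s p q)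

theorem subresultantMatrix_mulVec (r s k : ℕ) (p q : ℂ[X]) (c : Fin r ⊕ Fin s → ℂ)
    (i : Fin r ⊕ Fin s) : (subresultantMatrix r s k p q).mulVec c i =
      (bezoutCombination r s p q c).coeff (k + finSumFinEquiv i) := by
  rw [subresultantMatrix, LinearMap.toMatrix'_mulVec]
  rfl

/-- The coefficient vector of the cofactors `(a, b)` for which `a p + b q` has the same
coefficients of index `k, …, k + r + s - 1` as `x ^ k`, when the subresultant matrix is
nonsingular. -/
def cofactors (r s k : ℕ) (p q : ℂ[X]) : Fin r ⊕ Fin s → ℂ :=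
  (subresultantMatrix r s k p q)⁻¹.mulVec fun i => (X ^ k : ℂ[X]).coeff (k + finSumFinEquiv i)

/-- The combination `a p + b q` formed with the cofactors `(a, b)`. -/
def subresultantPoly (r s k : ℕ) (p q : ℂ[X]) : ℂ[X] :=
  bezoutCombination r s p q (cofactors r s k p q)

theorem dvd_subresultantPoly {r s k : ℕ} {p q d : ℂ[X]} (hp : d ∣ p) (hq : d ∣ q) :
    d ∣ subresultantPoly r s k p q :=
  dvd_add (hp.mul_left _) (hq.mul_left _)

theorem degree_ofFn_mul_lt {r m N : ℕ} {p : ℂ[X]} (hp : p.degree ≤ m) (h : r + m ≤ N)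
    (c : Fin r → ℂ) : (ofFn r c * p).degree < N := by
  by_cases hp0 : p = 0
  · rw [hp0, mul_zero, degree_zero]
    exact WithBot.bot_lt_coe N
  · rw [degree_mul]
    calc (ofFn r c).degree + p.degree < r + p.degree :=
          WithBot.add_lt_add_right (mt degree_eq_bot.1 hp0) (ofFn_degree_lt c)
      _ ≤ r + m := by gcongr
      _ ≤ N := by exact_mod_cast h

theorem degree_bezoutCombination_lt {r s m n N : ℕ} {p q : ℂ[X]} (hp : p.degree ≤ m)
    (hq : q.degree ≤ n) (h1 : r + m ≤ N) (h2 : s + n ≤ N) (c : Fin r ⊕ Fin s → ℂ) :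
    (bezoutCombination r s p q c).degree < N :=
  (degree_add_le _ _).trans_lt
    (max_lt (degree_ofFn_mul_lt hp h1 _) (degree_ofFn_mul_lt hq h2 _))

theorem coeff_eq_of_finSumFinEquiv {r s k : ℕ} {f g : ℂ[X]}
    (h : ∀ i : Fin r ⊕ Fin s, f.coeff (k + finSumFinEquiv i) = g.coeff (k + finSumFinEquiv i))
    {i : ℕ} (hi : k ≤ i) (hlt : i < k + (r + s)) : f.coeff i = g.coeff i := by
  have := h (finSumFinEquiv.symm ⟨i - k, by omega⟩)
  rwa [Equiv.apply_symm_apply, Fin.val_mk, Nat.add_sub_cancel' hi] at this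

/-- When the subresultant matrix is nonsingular, the combination formed with the cofactors is
`x ^ k` plus terms of lower degree. -/
theorem degree_subresultantPoly_sub_lt {r s k m n : ℕ} {p q : ℂ[X]} (hp : p.degree ≤ m)
    (hq : q.degree ≤ n) (h1 : r + m ≤ k + (r + s)) (h2 : s + n ≤ k + (r + s)) (hrs : 0 < r + s)
    (hdet : (subresultantMatrix r s k p q).det ≠ 0) :
    (subresultantPoly r s k p q - X ^ k).degree < (k : WithBot ℕ) := by
  rw [degree_lt_iff_coeff_zero]
  intro i hi
  rw [coeff_sub, sub_eq_zero]
  by_cases hlt : i < k + (r + s)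
  · refine coeff_eq_of_finSumFinEquiv (fun j => ?_) hi hlt
    rw [subresultantPoly, ← subresultantMatrix_mulVec, cofactors, Matrix.mulVec_mulVec,
      Matrix.mul_nonsing_inv _ (isUnit_iff_ne_zero.2 hdet), Matrix.one_mulVec]
  · rw [coeff_X_pow, if_neg (by omega)]
    refine coeff_eq_zero_of_degree_lt ((degree_bezoutCombination_lt hp hq h1 h2 _).trans_le ?_)
    exact_mod_cast not_lt.1 hlt

/-- If the gcd `u` of `p = u v` and `q = u w` has degree `k`, a combination `a p + b q` of degree
less than `k` vanishes. The bounds on the degrees of `a` and `b` then force `a = b = 0`. -/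
theorem det_subresultantMatrix_ne_zero {k m n : ℕ} (hkm : k ≤ m) (hkn : k ≤ n) {p q u v w : ℂ[X]}
    (hp : p.degree = m) (hq : q.degree = n) (hu : u.degree = k) (hpv : p = u * v)
    (hqw : q = u * w) (hvw : IsCoprime v w) :
    (subresultantMatrix (n - k + 1) (m - k) k p q).det ≠ 0 := by
  intro h0
  obtain ⟨c, hc, hc0⟩ := Matrix.exists_mulVec_eq_zero_iff.2 h0
  apply hc
  have hu0 : u ≠ 0 := by
    rintro rfl
    simp at hu
  have hdeg : (bezoutCombination (n - k + 1) (m - k) p q c).degree < k := by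
    rw [degree_lt_iff_coeff_zero]
    intro i hi
    by_cases hlt : i < k + (n - k + 1 + (m - k))
    · rw [← coeff_zero i]
      refine coeff_eq_of_finSumFinEquiv (fun j => ?_) hi hlt
      rw [← subresultantMatrix_mulVec, hc0, Pi.zero_apply, coeff_zero]
    · refine coeff_eq_zero_of_degree_lt ((degree_bezoutCombination_lt hp.le hq.le
        (N := k + (n - k + 1 + (m - k))) (by omega) (by omega) _).trans_le ?_)
      exact_mod_cast not_lt.1 hlt
  have hzero : ofFn (n - k + 1) (c ∘ Sum.inl) * p + ofFn (m - k) (c ∘ Sum.inr) * q = 0 := by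
    refine eq_zero_of_dvd_of_degree_lt ?_ (hdeg.trans_le hu.ge)
    exact dvd_add (Dvd.dvd.mul_left ⟨v, hpv⟩ _) (Dvd.dvd.mul_left ⟨w, hqw⟩ _)
  have hrel : ofFn (n - k + 1) (c ∘ Sum.inl) * v + ofFn (m - k) (c ∘ Sum.inr) * w = 0 := by
    refine (mul_eq_zero.1 ?_).resolve_left hu0
    rw [hpv, hqw] at hzero
    linear_combination hzero
  have hv : v.degree = (m - k : ℕ) := by
    have h := hp
    rw [hpv, degree_mul, hu] at h
    have hv0 : v ≠ 0 := by
      rintro rfl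
      simp at h
    rw [degree_eq_natDegree hv0] at h ⊢
    norm_cast at h ⊢
    omega
  have hb : ofFn (m - k) (c ∘ Sum.inr) = 0 := by
    refine eq_zero_of_dvd_of_degree_lt (hvw.dvd_of_dvd_mul_right ?_)
      ((ofFn_degree_lt _).trans_le hv.ge)
    exact ⟨-ofFn (n - k + 1) (c ∘ Sum.inl), by linear_combination hrel⟩
  have ha : ofFn (n - k + 1) (c ∘ Sum.inl) = 0 := by
    rw [hb, zero_mul, add_zero] at hrel
    refine (mul_eq_zero.1 hrel).resolve_right ?_
    rintro rfl
    simp at hv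
  have hca := injective_ofFn _ (ha.trans (map_zero _).symm)
  have hcb := injective_ofFn _ (hb.trans (map_zero _).symm)
  funext i
  rcases i with i | i
  · exact congrFun hca i
  · exact congrFun hcb i

section Smooth

variable {E : Type*} [NormedAddCommGroup E] [NormedSpace ℂ E] {S : Set E}

theorem CoeffContDiffOn.bezoutCombination {r s : ℕ} {p q : E → ℂ[X]}
    {c : E → Fin r ⊕ Fin s → ℂ} (hp : CoeffContDiffOn p S) (hq : CoeffContDiffOn q S)
    (hc : ContDiffOn ℂ 1 c S) :
    CoeffContDiffOn (fun x => GCDManifold.bezoutCombination r s (p x) (q x) (c x)) S := by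
  have hc' := contDiffOn_pi.1 hc
  exact ((coeffContDiffOn_ofFn (contDiffOn_pi' fun i => hc' (Sum.inl i))).mul hp).add
    ((coeffContDiffOn_ofFn (contDiffOn_pi' fun i => hc' (Sum.inr i))).mul hq)

theorem CoeffContDiffOn.subresultantMatrix {p q : E → ℂ[X]} (hp : CoeffContDiffOn p S)
    (hq : CoeffContDiffOn q S) (r s k : ℕ) (i j : Fin r ⊕ Fin s) :
    ContDiffOn ℂ 1 (fun x => GCDManifold.subresultantMatrix r s k (p x) (q x) i j) S := by
  simp only [GCDManifold.subresultantMatrix, LinearMap.toMatrix'_apply]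
  exact hp.bezoutCombination hq contDiffOn_const _

theorem CoeffContDiffOn.subresultantPoly {p q : E → ℂ[X]} (hp : CoeffContDiffOn p S)
    (hq : CoeffContDiffOn q S) {r s k : ℕ}
    (hdet : ∀ x ∈ S, (GCDManifold.subresultantMatrix r s k (p x) (q x)).det ≠ 0) :
    CoeffContDiffOn (fun x => GCDManifold.subresultantPoly r s k (p x) (q x)) S :=
  hp.bezoutCombination hq
    (contDiffOn_inv_mulVec _ (hp.subresultantMatrix hq r s k) hdet)

end Smooth

/-- The pairs of degrees exactly `m` and `n` whose subresultant matrix for `deg a ≤ n - k` and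
`deg b < m - k` is nonsingular. The classical `k`-th subresultant has `deg a < n - k`; allowing one
more degree in `a` multiplies the determinant by the leading coefficient of `p`, up to
sign, and keeps the system nonempty in the case `k = m = n`. -/
def regularPairs (m n k : ℕ) : Set (PolyPair m n) :=
  exactPairs m n ∩
    {z | (subresultantMatrix (n - k + 1) (m - k) k (z.fst : ℂ[X]) (z.snd : ℂ[X])).det ≠ 0}

theorem isOpen_regularPairs (m n k : ℕ) : IsOpen (regularPairs m n k) := by
  refine (isOpen_exactPairs m n).inter (isOpen_ne_fun (continuousOn_univ.1 ?_) continuous_const)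
  exact (contDiffOn_det ((coeffContDiffOn_fst Set.univ).subresultantMatrix
    (coeffContDiffOn_snd Set.univ) _ _ k)).continuousOn

/-- The candidate gcd of degree `k` of a pair, a combination `a p + b q`. It is monic of degree
`k` on the regular pairs, but need not divide `p` and `q` there. -/
def gcdCandidate (m n k : ℕ) (z : PolyPair m n) : ℂ[X] :=
  subresultantPoly (n - k + 1) (m - k) k (z.fst : ℂ[X]) (z.snd : ℂ[X])

variable {m n k : ℕ}

theorem gcdPairs_subset_regularPairs (hkm : k ≤ m) (hkn : k ≤ n) :
    gcdPairs m n k ⊆ regularPairs m n k := fun z hz => by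
  obtain ⟨hex, u, v, w, hu, hv, hw, hvw⟩ := mem_gcdPairs_iff.1 hz
  exact ⟨hex, det_subresultantMatrix_ne_zero hkm hkn hex.1 hex.2 hu hv hw hvw⟩

theorem degree_gcdCandidate_sub_lt (hkm : k ≤ m) (hkn : k ≤ n) {z : PolyPair m n}
    (hz : z ∈ regularPairs m n k) : (gcdCandidate m n k z - X ^ k).degree < (k : WithBot ℕ) :=
  degree_subresultantPoly_sub_lt hz.1.1.le hz.1.2.le (by omega) (by omega) (by omega) hz.2

theorem gcdCandidate_eq_X_pow_add (z : PolyPair m n) :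
    gcdCandidate m n k z = X ^ k + (gcdCandidate m n k z - X ^ k) := by ring

theorem monic_gcdCandidate (hkm : k ≤ m) (hkn : k ≤ n) {z : PolyPair m n}
    (hz : z ∈ regularPairs m n k) : (gcdCandidate m n k z).Monic := by
  rw [gcdCandidate_eq_X_pow_add]
  exact monic_X_pow_add (degree_gcdCandidate_sub_lt hkm hkn hz)

theorem degree_gcdCandidate (hkm : k ≤ m) (hkn : k ≤ n) {z : PolyPair m n}
    (hz : z ∈ regularPairs m n k) : (gcdCandidate m n k z).degree = k := by
  rw [gcdCandidate_eq_X_pow_add, degree_add_eq_left_of_degree_lt, degree_X_pow]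
  rw [degree_X_pow]
  exact degree_gcdCandidate_sub_lt hkm hkn hz

theorem degree_le_of_mem_regularPairs (hkm : k ≤ m) (hkn : k ≤ n) {z : PolyPair m n}
    (hz : z ∈ regularPairs m n k) {d : ℂ[X]} (hp : d ∣ (z.fst : ℂ[X])) (hq : d ∣ (z.snd : ℂ[X])) :
    d.degree ≤ k :=
  (degree_le_of_dvd (dvd_subresultantPoly hp hq) (monic_gcdCandidate hkm hkn hz).ne_zero).trans
    (degree_gcdCandidate hkm hkn hz).le

/-- On the regular pairs, a common divisor of degree `k` is a greatest one. -/
theorem mem_gcdPairs_of_dvd (hkm : k ≤ m) (hkn : k ≤ n) {z : PolyPair m n}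
    (hz : z ∈ regularPairs m n k) {u : ℂ[X]} (hu : u.degree = k) (hp : u ∣ (z.fst : ℂ[X]))
    (hq : u ∣ (z.snd : ℂ[X])) : z ∈ gcdPairs m n k :=
  ⟨hz.1, u, ⟨hp, hq, fun _ h1 h2 => (degree_le_of_mem_regularPairs hkm hkn hz h1 h2).trans hu.ge⟩,
    hu⟩

theorem gcdCandidate_eq_of_monic (hkm : k ≤ m) (hkn : k ≤ n) {z : PolyPair m n}
    (hz : z ∈ regularPairs m n k) {u : ℂ[X]} (hu : u.Monic) (hdeg : u.degree = k)
    (hp : u ∣ (z.fst : ℂ[X])) (hq : u ∣ (z.snd : ℂ[X])) : gcdCandidate m n k z = u :=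
  eq_of_monic_of_dvd_of_natDegree_le hu (monic_gcdCandidate hkm hkn hz)
    (dvd_subresultantPoly hp hq)
    (natDegree_le_natDegree ((degree_gcdCandidate hkm hkn hz).trans hdeg.symm).le)

theorem gcdCandidate_dvd (hkm : k ≤ m) (hkn : k ≤ n) {z : PolyPair m n}
    (hz : z ∈ gcdPairs m n k) :
    gcdCandidate m n k z ∣ (z.fst : ℂ[X]) ∧ gcdCandidate m n k z ∣ (z.snd : ℂ[X]) := by
  obtain ⟨-, u, ⟨hp, hq, -⟩, hu⟩ := id hz
  have hu0 : u ≠ 0 := by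
    rintro rfl
    simp at hu
  have hu' : (u * C u.leadingCoeff⁻¹) ∣ u :=
    (associated_mul_unit_left u _ (isUnit_C.2 (by simpa using hu0))).dvd
  have := gcdCandidate_eq_of_monic hkm hkn (gcdPairs_subset_regularPairs hkm hkn hz)
    (monic_mul_leadingCoeff_inv hu0) ((degree_mul_leadingCoeff_inv u hu0).trans hu)
    (hu'.trans hp) (hu'.trans hq)
  rw [this]
  exact ⟨hu'.trans hp, hu'.trans hq⟩

/-! ### Charts -/

/-- The coordinate space of the chart: the lower coefficients of a monic gcd of degree `k`, and the
coefficients of the two cofactors. -/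
abbrev ChartSpace (m n k : ℕ) : Type :=
  (Fin k → ℂ) × (Fin (m - k + 1) → ℂ) × (Fin (n - k + 1) → ℂ)

/-- The monic polynomial of degree `k` with given lower coefficients. -/
def monicOfCoeffs (k : ℕ) (a : Fin k → ℂ) : ℂ[X] :=
  X ^ k + ofFn k a

theorem monic_monicOfCoeffs (a : Fin k → ℂ) : (monicOfCoeffs k a).Monic :=
  monic_X_pow_add (ofFn_degree_lt a)

theorem degree_monicOfCoeffs (a : Fin k → ℂ) : (monicOfCoeffs k a).degree = k := by
  rw [monicOfCoeffs, degree_add_eq_left_of_degree_lt, degree_X_pow]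
  rw [degree_X_pow]
  exact ofFn_degree_lt a

theorem ofFn_toFn_of_degree_lt {N : ℕ} {p : ℂ[X]} (hp : p.degree < N) :
    ofFn N (toFn N p) = p := by
  ext i
  by_cases hi : i < N
  · rw [ofFn_coeff_eq_val_of_lt _ hi]
    rfl
  · rw [ofFn_coeff_eq_zero_of_ge _ (not_lt.1 hi),
      coeff_eq_zero_of_degree_lt (hp.trans_le (by exact_mod_cast not_lt.1 hi))]

theorem degree_monicOfCoeffs_mul_le (hkm : k ≤ m) (a : Fin k → ℂ) (b : Fin (m - k + 1) → ℂ) :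
    (monicOfCoeffs k a * ofFn (m - k + 1) b).degree ≤ m := by
  have h : (ofFn (m - k + 1) b).degree ≤ (m - k : ℕ) := by
    rw [degree_le_iff_coeff_zero]
    intro i hi
    exact ofFn_coeff_eq_zero_of_ge _ (by exact_mod_cast hi)
  rw [degree_mul, degree_monicOfCoeffs]
  calc (k : WithBot ℕ) + (ofFn (m - k + 1) b).degree ≤ k + (m - k : ℕ) := by gcongr
    _ = m := by
      norm_cast
      omega

/-- The parametrization `(u, v, w) ↦ (u v, u w)` with `u` monic of degree `k`. -/
def mulParam (m n k : ℕ) (y : ChartSpace m n k) : PolyPair m n :=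
  pairOfCoeffs m n (toFn (m + 1) (monicOfCoeffs k y.1 * ofFn (m - k + 1) y.2.1),
    toFn (n + 1) (monicOfCoeffs k y.1 * ofFn (n - k + 1) y.2.2))

theorem mulParam_fst (hkm : k ≤ m) (y : ChartSpace m n k) :
    ((mulParam m n k y).fst : ℂ[X]) = monicOfCoeffs k y.1 * ofFn (m - k + 1) y.2.1 :=
  pairOfCoeffs_fst (degree_monicOfCoeffs_mul_le hkm _ _) _

theorem mulParam_snd (hkn : k ≤ n) (y : ChartSpace m n k) :
    ((mulParam m n k y).snd : ℂ[X]) = monicOfCoeffs k y.1 * ofFn (n - k + 1) y.2.2 :=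
  pairOfCoeffs_snd (degree_monicOfCoeffs_mul_le hkn _ _) _

theorem contDiff_mulParam (m n k : ℕ) : ContDiff ℂ 1 (mulParam m n k) := by
  have hu : CoeffContDiffOn (fun y : ChartSpace m n k => monicOfCoeffs k y.1) Set.univ :=
    (coeffContDiffOn_const _).add (coeffContDiffOn_ofFn contDiff_fst.contDiffOn)
  have hv : CoeffContDiffOn (fun y : ChartSpace m n k => ofFn (m - k + 1) y.2.1) Set.univ :=
    coeffContDiffOn_ofFn (contDiff_fst.comp contDiff_snd).contDiffOn
  have hw : CoeffContDiffOn (fun y : ChartSpace m n k => ofFn (n - k + 1) y.2.2) Set.univ :=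
    coeffContDiffOn_ofFn (contDiff_snd.comp contDiff_snd).contDiffOn
  exact (pairOfCoeffs m n).contDiff.comp (contDiffOn_univ.1
    (((hu.mul hv).toFn (m + 1)).prodMk ((hu.mul hw).toFn (n + 1))))

/-- The chart `(p, q) ↦ (u, p / u, q / u)`, where `u` is the gcd candidate. -/
def gcdChart (m n k : ℕ) (z : PolyPair m n) : ChartSpace m n k :=
  (toFn k (gcdCandidate m n k z - X ^ k),
    toFn (m - k + 1) ((z.fst : ℂ[X]) /ₘ gcdCandidate m n k z),
    toFn (n - k + 1) ((z.snd : ℂ[X]) /ₘ gcdCandidate m n k z))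

theorem contDiffOn_gcdChart (hkm : k ≤ m) (hkn : k ≤ n) :
    ContDiffOn ℂ 1 (gcdChart m n k) (regularPairs m n k) := by
  have hp := coeffContDiffOn_fst (regularPairs m n k)
  have hq := coeffContDiffOn_snd (regularPairs m n k)
  have hu : CoeffContDiffOn (gcdCandidate m n k) (regularPairs m n k) :=
    hp.subresultantPoly hq fun z hz => hz.2
  have hmonic := fun z (hz : z ∈ regularPairs m n k) => monic_gcdCandidate hkm hkn hz
  have hdeg : ∀ z ∈ regularPairs m n k, (gcdCandidate m n k z).natDegree = k := fun z hz =>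
    natDegree_eq_of_degree_eq_some (degree_gcdCandidate hkm hkn hz)
  refine ContDiffOn.prodMk ?_ (ContDiffOn.prodMk ?_ ?_)
  · simpa only [sub_eq_add_neg] using (hu.add (coeffContDiffOn_const (-X ^ k))).toFn k
  · exact (hp.divByMonic hu hmonic hdeg fun z _ =>
      natDegree_le_of_degree_le (degree_fst_le z)).toFn _
  · exact (hq.divByMonic hu hmonic hdeg fun z _ =>
      natDegree_le_of_degree_le (degree_snd_le z)).toFn _

theorem degree_divByMonic_gcdCandidate_lt (hkm : k ≤ m) (hkn : k ≤ n) {z : PolyPair m n}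
    (hz : z ∈ regularPairs m n k) {p : ℂ[X]} {N : ℕ} (hp : p.degree ≤ N) :
    (p /ₘ gcdCandidate m n k z).degree < (N - k + 1 : ℕ) := by
  refine degree_le_natDegree.trans_lt ?_
  rw [natDegree_divByMonic _ (monic_gcdCandidate hkm hkn hz),
    natDegree_eq_of_degree_eq_some (degree_gcdCandidate hkm hkn hz)]
  have := natDegree_le_of_degree_le hp
  norm_cast
  omega

theorem mulParam_gcdChart (hkm : k ≤ m) (hkn : k ≤ n) {z : PolyPair m n}
    (hz : z ∈ gcdPairs m n k) : mulParam m n k (gcdChart m n k z) = z := by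
  have hreg := gcdPairs_subset_regularPairs hkm hkn hz
  have hu : monicOfCoeffs k (gcdChart m n k z).1 = gcdCandidate m n k z := by
    rw [monicOfCoeffs, gcdChart, ofFn_toFn_of_degree_lt (degree_gcdCandidate_sub_lt hkm hkn hreg),
      add_sub_cancel]
  have hdvd : ∀ p : ℂ[X], gcdCandidate m n k z ∣ p →
      gcdCandidate m n k z * (p /ₘ gcdCandidate m n k z) = p := by
    rintro p ⟨v, rfl⟩
    rw [mul_divByMonic_cancel_left _ (monic_gcdCandidate hkm hkn hreg)]
  obtain ⟨h1, h2⟩ := gcdCandidate_dvd hkm hkn hz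
  refine WithLp.ofLp_injective 2 (Prod.ext (Subtype.ext ?_) (Subtype.ext ?_))
  · refine (mulParam_fst hkm _).trans ?_
    rw [hu, gcdChart, ofFn_toFn_of_degree_lt
      (degree_divByMonic_gcdCandidate_lt hkm hkn hreg (degree_fst_le z))]
    exact hdvd _ h1
  · refine (mulParam_snd hkn _).trans ?_
    rw [hu, gcdChart, ofFn_toFn_of_degree_lt
      (degree_divByMonic_gcdCandidate_lt hkm hkn hreg (degree_snd_le z))]
    exact hdvd _ h2

theorem gcdChart_mulParam (hkm : k ≤ m) (hkn : k ≤ n) {y : ChartSpace m n k}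
    (hy : mulParam m n k y ∈ regularPairs m n k) : gcdChart m n k (mulParam m n k y) = y := by
  have hu : gcdCandidate m n k (mulParam m n k y) = monicOfCoeffs k y.1 :=
    gcdCandidate_eq_of_monic hkm hkn hy (monic_monicOfCoeffs _) (degree_monicOfCoeffs _)
      (mulParam_fst hkm y ▸ dvd_mul_right _ _) (mulParam_snd hkn y ▸ dvd_mul_right _ _)
  rw [gcdChart, hu, mulParam_fst hkm, mulParam_snd hkn,
    mul_divByMonic_cancel_left _ (monic_monicOfCoeffs _),
    mul_divByMonic_cancel_left _ (monic_monicOfCoeffs _), monicOfCoeffs, add_sub_cancel_left,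
    toFn_comp_ofFn_eq_id, toFn_comp_ofFn_eq_id, toFn_comp_ofFn_eq_id]

theorem mulParam_mem_gcdPairs (hkm : k ≤ m) (hkn : k ≤ n) {y : ChartSpace m n k}
    (hy : mulParam m n k y ∈ regularPairs m n k) : mulParam m n k y ∈ gcdPairs m n k :=
  mem_gcdPairs_of_dvd hkm hkn hy (degree_monicOfCoeffs y.1)
    (mulParam_fst hkm y ▸ dvd_mul_right _ _) (mulParam_snd hkn y ▸ dvd_mul_right _ _)

theorem isManifoldOfCodim_gcdPairs (hkm : k ≤ m) (hkn : k ≤ n) :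
    IsManifoldOfCodim k (gcdPairs m n k) := by
  have hrank : Module.finrank ℂ (ChartSpace m n k) =
      Module.finrank ℂ (EuclideanSpace ℂ (Fin (m + n + 2 - k))) := by
    simp only [Module.finrank_prod, Module.finrank_fin_fun, finrank_euclideanSpace_fin]
    omega
  let e : ChartSpace m n k ≃L[ℂ] EuclideanSpace ℂ (Fin (m + n + 2 - k)) :=
    ContinuousLinearEquiv.ofFinrankEq hrank
  refine ⟨m + n + 2 - k, fun x hx => ?_, by rw [finrank_polyPair]; omega⟩
  have hcont : ContDiff ℂ 1 fun y => mulParam m n k (e.symm y) :=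
    (contDiff_mulParam m n k).comp e.symm.contDiff
  have hleft : ∀ z ∈ gcdPairs m n k, mulParam m n k (e.symm (e (gcdChart m n k z))) = z :=
    fun z hz => by rw [e.symm_apply_apply, mulParam_gcdChart hkm hkn hz]
  refine ⟨regularPairs m n k, (fun y => mulParam m n k (e.symm y)) ⁻¹' regularPairs m n k,
    fun z => e (gcdChart m n k z), fun y => mulParam m n k (e.symm y),
    isOpen_regularPairs m n k, gcdPairs_subset_regularPairs hkm hkn hx,
    (isOpen_regularPairs m n k).preimage hcont.continuous,
    e.contDiff.comp_contDiffOn (contDiffOn_gcdChart hkm hkn), hcont.contDiffOn, ?_, ?_, ?_, ?_⟩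
  · rintro z ⟨hz, hzS⟩
    rw [Set.mem_preimage, hleft z hzS]
    exact hz
  · exact fun y hy => ⟨hy, mulParam_mem_gcdPairs hkm hkn hy⟩
  · exact fun z hz => hleft z hz.2
  · intro y hy
    exact (congrArg e (gcdChart_mulParam hkm hkn hy)).trans (e.apply_symm_apply y)

/-! ### Closures -/

theorem le_of_mem_closure_gcdPairs {j : ℕ} (hjm : j ≤ m) (hjn : j ≤ n) {z : PolyPair m n}
    (hz : z ∈ gcdPairs m n j) (hcl : z ∈ closure (gcdPairs m n k)) : k ≤ j := by
  obtain ⟨x, hxU, -, u, ⟨hp, hq, -⟩, hu⟩ := mem_closure_iff.1 hcl _ (isOpen_regularPairs m n j)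
    (gcdPairs_subset_regularPairs hjm hjn hz)
  have := degree_le_of_mem_regularPairs hjm hjn hxU hp hq
  rw [hu] at this
  exact_mod_cast this

/-- A point is in the closure of a set containing all but finitely many points of a complex line
through it. -/
theorem mem_closure_of_finite_line {E : Type*} [NormedAddCommGroup E] [NormedSpace ℂ E]
    {T : Set E} {z w : E} {F : Set ℂ} (hF : F.Finite) (h : ∀ ε ∉ F, z + ε • w ∈ T) :
    z ∈ closure T := by
  have hd : Dense (Set.univ \ F) := dense_univ.sdiff_finite hF
  have hc : Continuous fun ε : ℂ => z + ε • w := by fun_prop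
  have := map_mem_closure hc (hd 0) (t := T) fun ε hε => h ε hε.2
  simpa using this

theorem isCoprime_add_C {f g : ℂ[X]} (hf : f ≠ 0) {ε : ℂ}
    (hε : ε ∉ (f.roots.toFinset : Set ℂ).image fun a => -g.eval a) : IsCoprime f (g + C ε) := by
  rw [isCoprime_iff_aeval_ne_zero_of_isAlgClosed ℂ ℂ]
  intro a
  by_contra! h
  simp only [coe_aeval_eq_eval, eval_add, eval_C] at h
  refine hε ⟨a, ?_, by linear_combination -h.2⟩
  simpa [hf] using h.1

theorem degree_add_C_eq {g : ℂ[X]} (hg : g ≠ 0) {ε : ℂ} (hε : ε ≠ -g.coeff 0) :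
    (g + C ε).degree = g.degree := by
  rcases lt_or_ge 0 g.degree with h | h
  · exact degree_add_C h
  · rw [eq_C_of_degree_le_zero h] at hg ⊢
    rw [← C_add, degree_C, degree_C (by simpa using hg)]
    exact fun h0 => hε (by linear_combination h0)

theorem exists_dvd_degree_eq {u : ℂ[X]} {j : ℕ} (hu : u.degree = j) (hk : k ≤ j) :
    ∃ d : ℂ[X], d ∣ u ∧ d.degree = k := by
  induction k with
  | zero => exact ⟨1, one_dvd u, by simp⟩
  | succ k ih =>
    obtain ⟨d, ⟨v, rfl⟩, hd⟩ := ih (by omega)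
    have hv : v.degree ≠ 0 := by
      intro h
      rw [degree_mul, hd, h, add_zero] at hu
      have : k = j := by exact_mod_cast hu
      omega
    obtain ⟨a, ha⟩ := IsAlgClosed.exists_root v hv
    refine ⟨d * (X - C a), mul_dvd_mul_left d (dvd_iff_isRoot.2 ha), ?_⟩
    rw [degree_mul, hd, degree_X_sub_C]
    norm_cast

/-- Write `(p, q) = (d f, d g)` with `deg d = k`. For all but finitely many `ε`, the polynomials
`f` and `g + ε` are coprime, so that `(p, q + ε d)` has a gcd of degree `k`. -/
theorem gcdPairs_subset_closure {j : ℕ} (hk : k ≤ j) :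
    gcdPairs m n j ⊆ closure (gcdPairs m n k) := by
  rintro z ⟨⟨hzp, hzq⟩, u, ⟨hup, huq, -⟩, hu⟩
  obtain ⟨d, hdu, hd⟩ := exists_dvd_degree_eq hu hk
  obtain ⟨f, hf⟩ := hdu.trans hup
  obtain ⟨g, hg⟩ := hdu.trans huq
  have hf0 : f ≠ 0 := by
    rintro rfl
    simp [hf] at hzp
  have hg0 : g ≠ 0 := by
    rintro rfl
    simp [hg] at hzq
  have hdn : d.degree ≤ n :=
    hzq ▸ degree_le_of_dvd ⟨g, hg⟩ fun h => by simp [h] at hzq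
  refine mem_closure_of_finite_line (w := WithLp.toLp 2 (0, ⟨d, mem_degreeLE.2 hdn⟩))
    (((f.roots.toFinset.finite_toSet).image fun a => -g.eval a).union
      (Set.finite_singleton (-g.coeff 0))) fun ε hε => ?_
  rw [Set.mem_union, not_or] at hε
  have h1 : ((z + ε • (WithLp.toLp 2 (0, ⟨d, mem_degreeLE.2 hdn⟩) : PolyPair m n)).fst : ℂ[X]) =
      d * f := by
    simp [hf]
  have h2 : ((z + ε • (WithLp.toLp 2 (0, ⟨d, mem_degreeLE.2 hdn⟩) : PolyPair m n)).snd : ℂ[X]) =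
      d * (g + C ε) := by
    simp [hg, smul_eq_C_mul]
    ring
  refine mem_gcdPairs_iff.2 ⟨⟨?_, ?_⟩, d, f, g + C ε, hd, h1, h2, isCoprime_add_C hf0 hε.1⟩
  · rw [h1, ← hf, hzp]
  · rw [h2, degree_mul, degree_add_C_eq hg0 hε.2, ← degree_mul, ← hg, hzq]

theorem dense_exactPairs (m n : ℕ) : Dense (exactPairs m n) := by
  intro z
  refine mem_closure_of_finite_line
    (w := WithLp.toLp 2 (⟨X ^ m, mem_degreeLE.2 (degree_X_pow_le m)⟩,
      ⟨X ^ n, mem_degreeLE.2 (degree_X_pow_le n)⟩))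
    (Set.toFinite {-(z.fst : ℂ[X]).coeff m, -(z.snd : ℂ[X]).coeff n}) fun ε hε => ?_
  simp only [Set.mem_insert_iff, Set.mem_singleton_iff, not_or] at hε
  refine ⟨(degree_eq_iff_coeff_ne_zero (degree_fst_le _)).2 fun h => hε.1 ?_,
    (degree_eq_iff_coeff_ne_zero (degree_snd_le _)).2 fun h => hε.2 ?_⟩
  · simp at h
    linear_combination h
  · simp at h
    linear_combination h

theorem dense_gcdPairs_zero (m n : ℕ) : Dense (gcdPairs m n 0) := by
  refine ((dense_exactPairs m n).mono fun z hz => ?_).of_closure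
  obtain ⟨j, hj⟩ := exists_mem_gcdPairs hz
  exact gcdPairs_subset_closure j.zero_le hj

theorem gcdPairs_zero_eq_regularPairs (m n : ℕ) : gcdPairs m n 0 = regularPairs m n 0 :=
  (gcdPairs_subset_regularPairs m.zero_le n.zero_le).antisymm fun _ hz =>
    mem_gcdPairs_of_dvd m.zero_le n.zero_le hz (u := 1) (by simp) (one_dvd _) (one_dvd _)

theorem gcdPairs_nonempty {j : ℕ} (hjm : j ≤ m) (hjn : j ≤ n) : (gcdPairs m n j).Nonempty := by
  have hp : (X ^ j * X ^ (m - j) : ℂ[X]).degree = m := by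
    rw [← pow_add, Nat.add_sub_cancel' hjm, degree_X_pow]
  have hq : (X ^ j * (X + 1) ^ (n - j) : ℂ[X]).degree = n := by
    rw [degree_mul, degree_X_pow, degree_pow, ← C_1, degree_X_add_C, nsmul_one]
    norm_cast
    omega
  have h1 := pairOfCoeffs_fst (n := n) hp.le (toFn (n + 1) (X ^ j * (X + 1) ^ (n - j) : ℂ[X]))
  have h2 := pairOfCoeffs_snd (m := m) hq.le (toFn (m + 1) (X ^ j * X ^ (m - j) : ℂ[X]))
  refine ⟨_, mem_gcdPairs_iff.2 ⟨⟨?_, ?_⟩, X ^ j, _, _, degree_X_pow j, h1, h2, ?_⟩⟩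
  · rw [h1, hp]
  · rw [h2, hq]
  · exact IsCoprime.pow ⟨-1, 1, by ring⟩

end GCDManifold

end

theorem theorem4p1 (m n : ℕ) :
    (∀ k : ℕ, k ≤ min m n →
      GCDManifold.IsManifoldOfCodim k (GCDManifold.gcdPairs m n k)) ∧
    (∀ j k : ℕ, j ≤ min m n →
      (GCDManifold.gcdPairs m n j ⊆ closure (GCDManifold.gcdPairs m n k) ↔ k ≤ j)) ∧
    IsOpen (GCDManifold.gcdPairs m n 0) ∧
    Dense (GCDManifold.gcdPairs m n 0) := by
  refine ⟨fun k hk => GCDManifold.isManifoldOfCodim_gcdPairs (le_min_iff.1 hk).1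
    (le_min_iff.1 hk).2, fun j k hj => ⟨fun h => ?_, GCDManifold.gcdPairs_subset_closure⟩, ?_,
    GCDManifold.dense_gcdPairs_zero m n⟩
  · obtain ⟨hjm, hjn⟩ := le_min_iff.1 hj
    obtain ⟨z, hz⟩ := GCDManifold.gcdPairs_nonempty hjm hjn
    exact GCDManifold.le_of_mem_closure_gcdPairs hjm hjn hz (h hz)
  · rw [GCDManifold.gcdPairs_zero_eq_regularPairs]
    exact GCDManifold.isOpen_regularPairs m n 0
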